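/- Let $S$ be a quasi-compact scheme. Its pro-étale site $S_{\mathrm{p\acute e}}$ is the category of weakly étale $S$-schemes; a family $\{U_i\to X\}$ in it is a covering if it is jointly surjective and every affine open of $X$ is the image of a quasi-compact open of $\coprod_i U_i$. A hypercovering of $S$ is a simplicial object $U_\bullet$ of $S_{\mathrm{p\acute e}}$ such that $U_0\to S$ and all canonical morphisms $U_{n+1}\to \mathrm{cosk}_n(U_\bullet)_{n+1}$, $n\ge 0$, are coverings; let $\mathrm{Ho}(\mathrm{Hy}(S))$ be the category of hypercoverings of $S$ with morphisms taken modulo the equivalence relation generated by simplicial homotopy. For a space $X$ let $\pi(X)$ be the set of its connected components with the quotient topology, and apply $\pi$ degreewise to (the underlying spaces of) simplicial schemes. Let $\mathrm{Ho}(\mathrm{sTop})$ be the category of simplicial topological spaces with morphisms modulo the equivalence relation generated by simplicial homotopy. The pro-étale homotopy type of $S$ is the pro-object $$\Pi_{\mathrm{p\acute e}}(S)\colon \mathrm{Ho}(\mathrm{Hy}(S))\to \mathrm{Ho}(\mathrm{sTop}),\qquad U_\bullet\mapsto \pi(U_\bullet),$$ where a pro-object is a functor from a cofiltered category and $\mathrm{Hom}(X,Y)=\lim_j\operatorname{colim}_i\mathrm{Hom}(X_i,Y_j)$.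 An object $W$ of $S_{\mathrm{p\acute e}}$ is weakly contractible if evaluation at $W$ sends surjections of sheaves of sets to surjections. Theorem. Let $W_\bullet$ be a hypercovering of $S$ which is split (each $W_n$ is the disjoint union of its non-degenerate part and the degenerate copies of the lower non-degenerate parts) and such that every $W_n$ is an affine scheme and weakly contractible. Then the inclusion $\{W_\bullet\}\to\mathrm{Ho}(\mathrm{Hy}(S))$ of the one-point category at $W_\bullet$ is an initial functor. Moreover, $\mathrm{Ho}(\mathrm{Hy}(S))$ is cofiltered, and the canonical morphism of pro-objects in $\mathrm{Ho}(\mathrm{sTop})$ $$\Pi_{\mathrm{p\acute e}}(S)\to \pi(W_\bullet)$$ given by restriction along this inclusion is an isomorphism, where $\pi(W_\bullet)$ is regarded as a pro-object indexed by the one-point category. -/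

import Mathlib

open CategoryTheory Limits AlgebraicGeometry Opposite Simplicial

universe a b w v u

noncomputable section

namespace ProetaleHomotopy

/-! ### Pro-objects -/

/-- A pro-object in `C`: a functor from a (variable) cofiltered category into `C`. -/
structure ProObject (C : Type w) [Category.{v} C] where
  /-- the index category -/
  Index : Type a
  /-- the category structure on the index category -/
  [indexCategory : Category.{b} Index]
  /-- the index category is cofiltered -/
  [indexCofiltered : IsCofiltered Index]
  /-- the diagram -/
  diagram : Index ⥤ C

namespace ProObject

attribute [instance] indexCategory indexCofiltered

variable {C : Type w} [Category.{v} C]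

/-- The relation on pairs `(i, f : X i ⟶ c)` which identifies `(i, f)` with its restriction
along any `g : i' ⟶ i`. -/
def GermRel (X : ProObject.{a, b} C) (c : C)
    (p q : Σ i : X.Index, X.diagram.obj i ⟶ c) : Prop :=
  ∃ g : q.1 ⟶ p.1, q.2 = X.diagram.map g ≫ p.2

/-- The set `colim_i Hom (X i, c)`. -/
def Germ (X : ProObject.{a, b} C) (c : C) : Type _ := Quot (X.GermRel c)

/-- The class of `f : X i ⟶ c` in `colim_i Hom (X i, c)`. -/
def germ (X : ProObject.{a, b} C) {c : C} (i : X.Index) (f : X.diagram.obj i ⟶ c) : X.Germ c :=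
  Quot.mk _ ⟨i, f⟩

lemma germ_map (X : ProObject.{a, b} C) {c : C} {i i' : X.Index} (g : i' ⟶ i)
    (f : X.diagram.obj i ⟶ c) : X.germ i' (X.diagram.map g ≫ f) = X.germ i f :=
  (Quot.sound ⟨g, rfl⟩).symm

/-- The map `colim_i Hom (X i, c) → colim_i Hom (X i, c')` induced by `h : c ⟶ c'`. -/
def Germ.push {X : ProObject.{a, b} C} {c c' : C} (x : X.Germ c) (h : c ⟶ c') : X.Germ c' :=
  Quot.lift (fun p => X.germ p.1 (p.2 ≫ h)) (by
    rintro ⟨i, f⟩ ⟨i', f'⟩ ⟨g, hg⟩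
    dsimp at g hg ⊢
    subst hg
    rw [Category.assoc, germ_map]) x

@[simp]
lemma germ_push (X : ProObject.{a, b} C) {c c' : C} (i : X.Index) (f : X.diagram.obj i ⟶ c)
    (h : c ⟶ c') : (X.germ i f).push h = X.germ i (f ≫ h) := rfl

lemma Germ.exists_rep {X : ProObject.{a, b} C} {c : C} (x : X.Germ c) :
    ∃ (i : X.Index) (f : X.diagram.obj i ⟶ c), X.germ i f = x := by
  obtain ⟨⟨i, f⟩, rfl⟩ := Quot.exists_rep x
  exact ⟨i, f, rfl⟩

@[simp]
lemma Germ.push_id {X : ProObject.{a, b} C} {c : C} (x : X.Germ c) : x.push (𝟙 c) = x := by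
  obtain ⟨i, f, rfl⟩ := x.exists_rep
  simp

@[simp]
lemma Germ.push_push {X : ProObject.{a, b} C} {c c' c'' : C} (x : X.Germ c) (h : c ⟶ c')
    (k : c' ⟶ c'') : (x.push h).push k = x.push (h ≫ k) := by
  obtain ⟨i, f, rfl⟩ := x.exists_rep
  simp

/-- Morphisms of pro-objects: `Hom (X, Y) = lim_j colim_i Hom (X i, Y j)`. -/
@[ext]
structure Hom (X Y : ProObject.{a, b} C) where
  /-- the component at `j`, an element of `colim_i Hom (X i, Y j)` -/
  comp (j : Y.Index) : X.Germ (Y.diagram.obj j)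
  /-- the components are compatible -/
  compat {j j' : Y.Index} (g : j ⟶ j') : (comp j).push (Y.diagram.map g) = comp j'

/-- Substituting a morphism of pro-objects `X ⟶ Y` into an element of `colim_j Hom (Y j, c)`. -/
def Hom.pull {X Y : ProObject.{a, b} C} (F : Hom X Y) {c : C} (y : Y.Germ c) : X.Germ c :=
  Quot.lift (fun p => (F.comp p.1).push p.2) (by
    rintro ⟨j, f⟩ ⟨j', f'⟩ ⟨g, hg⟩
    dsimp at g hg ⊢
    subst hg
    rw [← Germ.push_push, F.compat]) y

@[simp]
lemma Hom.pull_germ {X Y : ProObject.{a, b} C} (F : Hom X Y) {c : C} (j : Y.Index)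
    (f : Y.diagram.obj j ⟶ c) : F.pull (Y.germ j f) = (F.comp j).push f := rfl

lemma Hom.pull_push {X Y : ProObject.{a, b} C} (F : Hom X Y) {c c' : C} (y : Y.Germ c)
    (h : c ⟶ c') : F.pull (y.push h) = (F.pull y).push h := by
  obtain ⟨j, f, rfl⟩ := y.exists_rep
  simp

/-- The category of pro-objects in `C`. -/
instance : Category (ProObject.{a, b} C) where
  Hom := Hom
  id X :=
    { comp := fun i => X.germ i (𝟙 _)
      compat := fun g => by
        rw [germ_push, Category.id_comp, ← X.germ_map g (𝟙 _), Category.comp_id] }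
  comp F G :=
    { comp := fun k => F.pull (G.comp k)
      compat := fun g => by rw [← Hom.pull_push, G.compat] }
  id_comp {X Y} F := by
    refine Hom.ext (funext fun j => ?_)
    obtain ⟨i, f, hf⟩ := (F.comp j).exists_rep
    simp [← hf]
  comp_id {X Y} F := by
    refine Hom.ext (funext fun j => ?_)
    simp
  assoc {X Y Z T} F G H := by
    refine Hom.ext (funext fun l => ?_)
    obtain ⟨k, f, hf⟩ := (H.comp l).exists_rep
    simp [← hf, Hom.pull_push]

/-- The category with one object and one morphism. -/
inductive Point : Type a where
  | star

instance : Category.{b} Point.{a} where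
  Hom _ _ := PUnit.{b + 1}
  id _ := PUnit.unit
  comp _ _ := PUnit.unit

instance : IsCofiltered Point.{a} where
  cone_objs _ _ := ⟨.star, PUnit.unit, PUnit.unit, trivial⟩
  cone_maps _ _ _ _ := ⟨.star, PUnit.unit, rfl⟩
  nonempty := ⟨.star⟩

/-- An object of `C`, regarded as a pro-object indexed by the one-point category. -/
abbrev const (c : C) : ProObject.{a, b} C where
  Index := Point.{a}
  diagram := (Functor.const _).obj c

/-- The canonical morphism from a pro-object `X` to its value at an index `i` (restriction along
the inclusion of `i` into the index category): it is the class of the identity of `X i`. -/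
def toConst (X : ProObject.{a, b} C) (i : X.Index) : X ⟶ const (X.diagram.obj i) :=
  Hom.mk (fun _ => X.germ i (𝟙 (X.diagram.obj i))) (fun _ => by
    exact Germ.push_id _)

end ProObject

/-! ### Homotopy categories of simplicial objects -/

/-- The relation of being simplicially homotopic. -/
def homotopyRel (C : Type w) [Category.{v} C] : HomRel (SimplicialObject C) :=
  fun _ _ f g => Nonempty (SimplicialObject.Homotopy f g)

/-- The homotopy category of simplicial objects in `C`: the same objects, and morphisms modulo
the equivalence relation generated by simplicial homotopy. -/
abbrev HoSimplicial (C : Type w) [Category.{v} C] := CategoryTheory.Quotient (homotopyRel C)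

/-! ### Spaces of components -/

/-- The functor sending a space to its space of components, i.e. the set of its connected
components with the quotient topology. -/
def componentsFunctor : TopCat.{u} ⥤ TopCat.{u} where
  obj X := TopCat.of (ConnectedComponents X)
  map f := TopCat.ofHom ⟨f.hom.continuous.connectedComponentsMap,
    f.hom.continuous.connectedComponentsMap_continuous⟩
  map_id X := by
    ext x
    obtain ⟨x, rfl⟩ := ConnectedComponents.surjective_coe x
    rfl
  map_comp f g := by
    ext x
    obtain ⟨x, rfl⟩ := ConnectedComponents.surjective_coe x
    rfl

variable (S : Scheme.{u})

/-- The space of components of (the underlying space of) an object of the pro-étale site. -/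
def proEtComponents : S.ProEt ⥤ TopCat.{u} :=
  Scheme.ProEt.forget S ⋙ Over.forget S ⋙ Scheme.forgetToTop ⋙ componentsFunctor

/-- The levelwise space of components of a simplicial object of the pro-étale site. -/
def simplicialComponents : SimplicialObject S.ProEt ⥤ SimplicialObject TopCat.{u} :=
  (SimplicialObject.whiskering _ _).obj (proEtComponents S)

/-! ### Hypercoverings -/

instance (n : ℕ) : Finite (SimplexCategory.Truncated n) :=
  Finite.of_injective
    (fun X => (⟨X.obj.len, Nat.lt_succ_of_le X.property⟩ : Fin (n + 1))) (by
      rintro ⟨X, hX⟩ ⟨Y, hY⟩ h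
      have h' : X = Y := SimplexCategory.ext (by simpa using h)
      subst h'
      rfl)

instance (n : ℕ) (X Y : SimplexCategory.Truncated n) : Finite (X ⟶ Y) :=
  Finite.of_injective (fun f => f.hom) (fun _ _ h => ObjectProperty.hom_ext _ h)

instance (n : ℕ) (Δ : SimplexCategoryᵒᵖ) :
    Finite (StructuredArrow Δ (SimplexCategory.Truncated.inclusion n).op) :=
  
  have : Finite (SimplexCategory.Truncated n)ᵒᵖ := Finite.of_equiv _ equivToOpposite
  have : ∀ X : (SimplexCategory.Truncated n)ᵒᵖ,
      Finite (unop ((SimplexCategory.Truncated.inclusion n).op.obj X) ⟶ unop Δ) :=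
    fun X => inferInstanceAs (Finite ((_ : SimplexCategory) ⟶ _))
  Finite.of_injective
    (β := Σ X : (SimplexCategory.Truncated n)ᵒᵖ,
      ((SimplexCategory.Truncated.inclusion n).op.obj X).unop ⟶ Δ.unop)
    (fun X => ⟨X.right, X.hom.unop⟩) (by
      rintro ⟨⟨⟨⟩⟩, X, f⟩ ⟨⟨⟨⟩⟩, Y, g⟩ h
      obtain ⟨rfl, h⟩ := Sigma.mk.inj_iff.1 h
      have h' : f = g := Quiver.Hom.unop_inj (eq_of_heq h)
      subst h'
      rfl)

/-- Coskeleta exist in any category with finite limits. -/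
instance {C : Type w} [Category.{v} C] [HasFiniteLimits C] (n : ℕ)
    (F : (SimplexCategory.Truncated n)ᵒᵖ ⥤ C) :
    (SimplexCategory.Truncated.inclusion n).op.HasPointwiseRightKanExtension F := by
  intro Δ
  have : FinCategory (StructuredArrow Δ (SimplexCategory.Truncated.inclusion n).op) :=
    { fintypeObj := Fintype.ofFinite _
      fintypeHom := fun X Y =>
        have : Finite (X ⟶ Y) := Finite.of_injective (fun f => f.right.unop)
          (fun f g h => StructuredArrow.hom_ext _ _ (Quiver.Hom.unop_inj h))
        Fintype.ofFinite _ }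
  exact inferInstanceAs (HasLimit _)

variable {S}

/-- The single morphism `f` is a covering in the pro-étale site. -/
def IsCovering {U X : S.ProEt} (f : U ⟶ X) : Prop :=
  Presieve.singleton f ∈ Scheme.ProEt.precoverage S X

/-- A hypercovering of `S`: a simplicial object `U` of the pro-étale site of `S` such that
`U 0 → S` and all the canonical morphisms `U (n + 1) → (cosk_n U) (n + 1)` are coverings. -/
structure IsHypercovering (U : SimplicialObject S.ProEt) : Prop where
  zero : IsCovering (terminal.from (U _⦋0⦌))
  succ (n : ℕ) : IsCovering (((SimplicialObject.coskAdj n).unit.app U).app (op ⦋n + 1⦌))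

/-- A weakly contractible object of the pro-étale site: evaluation at `W` sends surjections of
sheaves of sets to surjections of sets. -/
def IsWeaklyContractible (W : S.ProEt) : Prop :=
  ∀ (F G : Sheaf (Scheme.ProEt.topology S) (Type u)) (φ : F ⟶ G),
    Sheaf.IsLocallySurjective φ → Function.Surjective (φ.hom.app (op W))

/-- A simplicial object of the pro-étale site which is affine and weakly contractible in each
degree. -/
def IsAffineWeaklyContractible (W : SimplicialObject S.ProEt) : Prop :=
  ∀ n : ℕ, IsAffine (W _⦋n⦌).left ∧ IsWeaklyContractible (W _⦋n⦌)

/-- A split simplicial object: each `W n` is the disjoint union of the (degenerate copies of the)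
nondegenerate parts. -/
def IsSplit (W : SimplicialObject S.ProEt) : Prop :=
  Nonempty (SimplicialObject.Splitting W)

variable (S)

/-- The category of hypercoverings of `S`. -/
abbrev Hy := ObjectProperty.FullSubcategory (fun U : SimplicialObject S.ProEt => IsHypercovering U)

/-- The inclusion of hypercoverings into simplicial objects of the pro-étale site. -/
abbrev hyInclusion : Hy S ⥤ SimplicialObject S.ProEt :=
  ObjectProperty.ι _

/-- The relation of being simplicially homotopic for morphisms of hypercoverings. -/
def hyHomotopyRel : HomRel (Hy S) :=
  fun _ _ f g => homotopyRel S.ProEt ((hyInclusion S).map f) ((hyInclusion S).map g)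

/-- The homotopy category of hypercoverings of `S`. -/
abbrev HoHy := CategoryTheory.Quotient (hyHomotopyRel S)

/-- The functor `U ↦ π(U)` from the homotopy category of hypercoverings of `S` to the homotopy
category of simplicial spaces. -/
def homotopyComponents : HoHy S ⥤ HoSimplicial TopCat.{u} :=
  CategoryTheory.Quotient.lift _ (hyInclusion S ⋙ simplicialComponents S ⋙ CategoryTheory.Quotient.functor _) (by
    rintro U V f g ⟨H⟩
    exact CategoryTheory.Quotient.sound _ ⟨H.whiskerRight (proEtComponents S)⟩)

/-- The pro-étale homotopy type of `S`: the pro-object `U ↦ π(U)` in the homotopy category of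
simplicial spaces, indexed by the homotopy category of hypercoverings of `S`. -/
abbrev proEtHomotopyType [IsCofiltered (HoHy S)] : ProObject.{u + 1, u} (HoSimplicial TopCat.{u}) where
  Index := HoHy S
  diagram := homotopyComponents S

variable {S}

/-- A hypercovering, as an object of the homotopy category of hypercoverings. -/
def toHoHy (W : SimplicialObject S.ProEt) (hW : IsHypercovering W) : HoHy S :=
  (CategoryTheory.Quotient.functor _).obj ⟨W, hW⟩

/-- The levelwise space of components of a simplicial object of the pro-étale site, as an object of
the homotopy category of simplicial spaces. -/
def componentsHo (W : SimplicialObject S.ProEt) : HoSimplicial TopCat.{u} :=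
  (CategoryTheory.Quotient.functor _).obj ((simplicialComponents S).obj W)

/-- The canonical morphism of pro-objects from the pro-étale homotopy type of `S` to the simplicial
space of components of a hypercovering `W`, induced by the inclusion of `W` into the homotopy
category of hypercoverings. -/
def proEtHomotopyTypeTo [IsCofiltered (HoHy S)] (W : SimplicialObject S.ProEt)
    (hW : IsHypercovering W) : proEtHomotopyType S ⟶ ProObject.const (componentsHo W) :=
  ProObject.toConst (proEtHomotopyType S) (toHoHy W hW)

end ProetaleHomotopy

end

/-!
The point is that `W` is an *initial object* of the homotopy category of hypercoverings. Given this,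
the inclusion of the one-point category at `W` is an initial functor, the category is cofiltered,
and every pro-object indexed by it is isomorphic to its value at `W`
(`ProObject.isIso_toConst`). So for every hypercovering `U` there has to be a morphism `W ⟶ U`, and
any two such morphisms have to be homotopic.

For an object `T` of the pro-étale site, consider the simplicial set `T ⟶ U _` of `T`-points of `U`.
If `T` is weakly contractible, then morphisms from `T` lift along coverings
(`IsWeaklyContractible.exists_lift`), because a covering is a surjection of representable sheaves.
A map from `∂Δ[n + 1]` to the `T`-points of `U` is a morphism from `T` to `cosk n U` in degree
`n + 1`, so the hypercovering condition says that such maps extend to `Δ[n + 1]`; as all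
monomorphisms of simplicial sets are built from boundary inclusions, maps to the `T`-points of `U`
extend along all monomorphisms (`homSSet_extendsAlongMono`, `IsHypercovering.extendsAlongMono`).

A morphism `W ⟶ U` is a natural family of maps `Δ[n] ⟶ (W n ⟶ U _)`, and a homotopy is a natural
family of maps `Δ[1] ⊗ Δ[n] ⟶ (W n ⟶ U _)`. Both are instances of the problem of extending a
family given on `K ⊗ Δ[n]`, for a subcomplex `K` of `L`, to `L ⊗ Δ[n]`: take `K` empty for the
existence of a morphism, and `K = ∂Δ[1]`, `L = Δ[1]` for a homotopy. It is solved by induction on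
`n` (`exists_extension`, `exists_tensor_extension`). In dimension `n` the family is known on
`K ⊗ Δ[n] ∪ L ⊗ ∂Δ[n]` and extends to `L ⊗ Δ[n]` because the inclusion is a monomorphism. This
extension need not be compatible with the degeneracies of `W`, but only its restriction to the
nondegenerate part of `W n` is kept: since `W` is split, the values on the degenerate parts can be
chosen to be those that naturality prescribes.
-/

noncomputable section

namespace ProetaleHomotopy

/-! ### Skeletal induction for cosimplicial objects -/

section SkeletalInduction

open SimplicialObject.Splitting

variable {D : Type w} [Category.{v} D] {G Z Z' : SimplexCategory ⥤ D}
  {M : SimplexCategory → D}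

/-- The fan on `G Δ` given by the maps `G Δ ⟶ G Δ' ⟶ M Δ'`, for all epimorphisms `Δ ⟶ Δ'`. If it
is a limit for all `Δ`, then `G` is dual to a split simplicial object, with `M Δ` dual to the
nondegenerate part. -/
abbrev cosplitFan (pr : ∀ Δ, G.obj Δ ⟶ M Δ) (Δ : SimplexCategory) :
    Fan (fun A : IndexSet (op Δ) => M A.1.unop) :=
  Fan.mk (G.obj Δ) (fun A => G.map A.e ≫ pr A.1.unop)

lemma cosplit_hom_ext {pr : ∀ Δ, G.obj Δ ⟶ M Δ} (hG : ∀ Δ, IsLimit (cosplitFan pr Δ))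
    {Δ : SimplexCategory} {T : D} {f g : T ⟶ G.obj Δ}
    (h : ∀ A : IndexSet (op Δ), f ≫ G.map A.e ≫ pr _ = g ≫ G.map A.e ≫ pr _) : f = g :=
  Fan.IsLimit.hom_ext (hG Δ) _ _ h

/-- An operator between objects of the same dimension is either the identity or factors through an
object of smaller dimension. -/
lemma eqToHom_or_image_len_lt {Δ Δ' : SimplexCategory} (θ : Δ ⟶ Δ') (h : Δ.len = Δ'.len) :
    (∃ e : Δ = Δ', θ = eqToHom e) ∨ (image θ).len < Δ.len := by
  obtain rfl : Δ = Δ' := SimplexCategory.ext h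
  by_cases h' : (image θ).len < Δ.len
  · exact Or.inr h'
  · have : Epi θ := by
      rw [← image.fac θ]
      have h₁ : Δ = image θ := by
        by_contra h₂
        exact h' (SimplexCategory.len_lt_of_mono (image.ι θ) h₂)
      have : Epi (image.ι θ) := by
        have : IsIso (image.ι θ) :=
          (SimplexCategory.isIso_iff_of_mono _).2 (congr_arg SimplexCategory.len h₁.symm)
        infer_instance
      infer_instance
    exact Or.inl ⟨rfl, SimplexCategory.eq_id_of_epi θ⟩

/-- The maps `Z Δ ⟶ G Δ`, for `Δ` of dimension `< n`, that are natural and have prescribed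
restrictions `b` along `j : Z' ⟶ Z`. -/
structure PartialExtension (j : Z' ⟶ Z) (b : Z' ⟶ G) (n : ℕ) where
  /-- the map in dimensions `< n` -/
  app (Δ : SimplexCategory) (h : Δ.len < n) : Z.obj Δ ⟶ G.obj Δ
  naturality {Δ Δ' : SimplexCategory} (h : Δ.len < n) (h' : Δ'.len < n) (θ : Δ ⟶ Δ') :
    Z.map θ ≫ app Δ' h' = app Δ h ≫ G.map θ
  comp_app (Δ : SimplexCategory) (h : Δ.len < n) : j.app Δ ≫ app Δ h = b.app Δ

/-- The map `y : Z Δ ⟶ G Δ` is compatible with `b` and, along all operators `Δ' ⟶ Δ` with `Δ'` of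
dimension `< n`, with `x`. For `Δ` of dimension `n`, this is naturality with respect to faces;
nothing is required of the operators `Δ ⟶ Δ'`. -/
structure PartialExtension.IsFaceCompatible {j : Z' ⟶ Z} {b : Z' ⟶ G} {n : ℕ}
    (x : PartialExtension j b n) {Δ : SimplexCategory} (y : Z.obj Δ ⟶ G.obj Δ) : Prop where
  map_comp {Δ' : SimplexCategory} (h : Δ'.len < n) (θ : Δ' ⟶ Δ) :
    Z.map θ ≫ y = x.app Δ' h ≫ G.map θ
  comp : j.app Δ ≫ y = b.app Δ

namespace PartialExtension

variable {j : Z' ⟶ Z} {b : Z' ⟶ G} {n : ℕ} (x : PartialExtension j b n)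

open scoped Classical in
/-- The map which agrees with `y` on the nondegenerate part and with what `x` forces on the
degenerate parts. -/
def correct {pr : ∀ Δ, G.obj Δ ⟶ M Δ} (hG : ∀ Δ, IsLimit (cosplitFan pr Δ))
    {Δ : SimplexCategory} (y : Z.obj Δ ⟶ G.obj Δ) : Z.obj Δ ⟶ G.obj Δ :=
  Fan.IsLimit.lift (hG Δ) (fun A =>
    if h : A.1.unop.len < n then Z.map A.e ≫ x.app _ h ≫ pr _ else y ≫ G.map A.e ≫ pr _)

section

variable {pr : ∀ Δ, G.obj Δ ⟶ M Δ} (hG : ∀ Δ, IsLimit (cosplitFan pr Δ))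
    {Δ : SimplexCategory} (y : Z.obj Δ ⟶ G.obj Δ)

lemma correct_of_lt (A : IndexSet (op Δ)) (h : A.1.unop.len < n) :
    x.correct hG y ≫ G.map A.e ≫ pr A.1.unop = Z.map A.e ≫ x.app _ h ≫ pr _ := by
  have := Fan.IsLimit.fac (hG Δ) (fun A =>
    if h : A.1.unop.len < n then Z.map A.e ≫ x.app _ h ≫ pr _ else y ≫ G.map A.e ≫ pr _) A
  rwa [dif_pos h] at this

lemma correct_of_not_lt (A : IndexSet (op Δ)) (h : ¬ A.1.unop.len < n) :
    x.correct hG y ≫ G.map A.e ≫ pr A.1.unop = y ≫ G.map A.e ≫ pr _ := by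
  have := Fan.IsLimit.fac (hG Δ) (fun A =>
    if h : A.1.unop.len < n then Z.map A.e ≫ x.app _ h ≫ pr _ else y ≫ G.map A.e ≫ pr _) A
  rwa [dif_neg h] at this

variable {y}

/-- Correcting `y` on the degenerate parts does not affect the compatibility with faces. -/
lemma correct_isFaceCompatible (hy : x.IsFaceCompatible y) :
    x.IsFaceCompatible (x.correct hG y) where
  map_comp {Δ'} h θ := by
    refine cosplit_hom_ext hG fun A => ?_
    by_cases hA : A.1.unop.len < n
    · rw [Category.assoc, correct_of_lt _ _ _ _ hA, ← Z.map_comp_assoc,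
        reassoc_of% (x.naturality h hA (θ ≫ A.e)), G.map_comp]
      simp
    · rw [Category.assoc, correct_of_not_lt _ _ _ _ hA, reassoc_of% (hy.map_comp h θ)]
      simp
  comp := by
    refine cosplit_hom_ext hG fun A => ?_
    by_cases hA : A.1.unop.len < n
    · rw [Category.assoc, correct_of_lt _ _ _ _ hA, ← j.naturality_assoc,
        reassoc_of% (x.comp_app _ hA), b.naturality_assoc]
    · rw [Category.assoc, correct_of_not_lt _ _ _ _ hA, reassoc_of% hy.comp]

variable (y) in
/-- The corrected map is natural with respect to degeneracies: each of the components to be compared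
factors through a degenerate part of `G Δ`. -/
lemma map_comp_app_of_epi {Δ' : SimplexCategory} (h : Δ'.len < n) (π : Δ ⟶ Δ') [Epi π] :
    Z.map π ≫ x.app Δ' h = x.correct hG y ≫ G.map π := by
  refine cosplit_hom_ext hG fun B => ?_
  have hB : B.1.unop.len < n := (SimplexCategory.len_le_of_epi B.e).trans_lt h
  have h' : x.correct hG y ≫ G.map (π ≫ B.e) ≫ pr B.1.unop =
      Z.map (π ≫ B.e) ≫ x.app B.1.unop hB ≫ pr B.1.unop :=
    x.correct_of_lt hG y (IndexSet.mk (π ≫ B.e)) hB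
  rw [G.map_comp, Z.map_comp, Category.assoc, Category.assoc,
    reassoc_of% (x.naturality h hB B.e)] at h'
  rw [Category.assoc, Category.assoc, h']

variable (y) in
/-- The corrected map is natural with respect to all operators to objects of dimension `< n`. -/
lemma map_comp_app {Δ' : SimplexCategory} (h : Δ'.len < n) (θ : Δ ⟶ Δ') :
    Z.map θ ≫ x.app Δ' h = x.correct hG y ≫ G.map θ := by
  have h' : (image θ).len < n := (SimplexCategory.len_le_of_mono (image.ι θ)).trans_lt h
  rw [← image.fac θ, Z.map_comp, Category.assoc, x.naturality h' h,
    reassoc_of% (x.map_comp_app_of_epi hG y h' (factorThruImage θ)), G.map_comp]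

end

open scoped Classical in
lemma exists_succ {pr : ∀ Δ, G.obj Δ ⟶ M Δ} (hG : ∀ Δ, IsLimit (cosplitFan pr Δ))
    (hx : ∀ Δ : SimplexCategory, Δ.len = n → ∃ y : Z.obj Δ ⟶ G.obj Δ, x.IsFaceCompatible y) :
    ∃ x' : PartialExtension j b (n + 1), ∀ Δ (h : Δ.len < n), x'.app Δ (Nat.lt_succ_of_lt h) = x.app Δ h := by
  choose y hy using hx
  refine ⟨{ app Δ h := if h' : Δ.len < n then x.app Δ h' else x.correct hG (y Δ (by lia))
            naturality := ?_
            comp_app := ?_ }, fun Δ h => dif_pos h⟩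
  · intro Δ Δ' h h' θ
    -- only operators between two objects of dimension `n` need an argument of their own
    by_cases hΔ : Δ.len < n <;> by_cases hΔ' : Δ'.len < n
    · simp only [hΔ, hΔ', dite_true, x.naturality]
    · simp only [hΔ, hΔ', dite_true, dite_false]
      exact (x.correct_isFaceCompatible hG (hy _ _)).map_comp hΔ θ
    · simp only [hΔ, hΔ', dite_true, dite_false]
      exact x.map_comp_app hG _ _ _
    · simp only [hΔ, hΔ', dite_false]
      obtain ⟨rfl, rfl⟩ | hθ := eqToHom_or_image_len_lt θ (by lia)
      · simp
      · have hi : (image θ).len < n := by lia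
        rw [← image.fac θ, Z.map_comp, Category.assoc,
          (x.correct_isFaceCompatible hG (hy _ _)).map_comp hi,
          reassoc_of% (x.map_comp_app hG _ hi), G.map_comp]
  · intro Δ h
    by_cases hΔ : Δ.len < n
    · simp only [hΔ, dite_true, x.comp_app]
    · simp only [hΔ, dite_false]
      exact (x.correct_isFaceCompatible hG (hy _ _)).comp

end PartialExtension

open PartialExtension in
/-- Skeletal induction: to extend a natural transformation `b : Z' ⟶ G` along `j : Z' ⟶ Z` when `G`
is dual to a split simplicial object, it suffices to be able, in each dimension, to find a map which
is compatible with `b` and with what has been constructed on the faces. The degeneracies take care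
of themselves. -/
theorem exists_extension {pr : ∀ Δ, G.obj Δ ⟶ M Δ} (hG : ∀ Δ, IsLimit (cosplitFan pr Δ))
    (j : Z' ⟶ Z) (b : Z' ⟶ G)
    (hstep : ∀ (n : ℕ) (x : PartialExtension j b n) (Δ : SimplexCategory), Δ.len = n →
      ∃ y : Z.obj Δ ⟶ G.obj Δ, x.IsFaceCompatible y) :
    ∃ h : Z ⟶ G, j ≫ h = b := by
  choose succ hsucc using fun (n : ℕ) (x : PartialExtension j b n) => x.exists_succ hG (hstep n x)
  let x : ∀ n, PartialExtension j b n := Nat.rec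
    { app _ h := absurd h (Nat.not_lt_zero _)
      naturality h := absurd h (Nat.not_lt_zero _)
      comp_app _ h := absurd h (Nat.not_lt_zero _) } succ
  have hx (n m : ℕ) (Δ) (h : Δ.len < n) :
      (x (n + m)).app Δ (h.trans_le (Nat.le_add_right n m)) = (x n).app Δ h := by
    induction m with
    | zero => rfl
    | succ m ih => exact (hsucc _ (x (n + m)) Δ _).trans ih
  have hx' {n m : ℕ} (Δ) (h : Δ.len < n) (h' : Δ.len < m) : (x n).app Δ h = (x m).app Δ h' := by
    obtain ⟨k, rfl | rfl⟩ : ∃ k, m = n + k ∨ n = m + k := by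
      obtain h | h := le_total n m
      · exact ⟨m - n, by lia⟩
      · exact ⟨n - m, by lia⟩
    · exact (hx _ _ _ _).symm
    · exact hx _ _ _ _
  refine ⟨{ app Δ := (x (Δ.len + 1)).app Δ (Nat.lt_succ_self _), naturality := fun Δ Δ' θ => ?_ },
    ?_⟩
  · rw [hx' (m := max Δ.len Δ'.len + 1) Δ' _ (by lia),
      hx' (m := max Δ.len Δ'.len + 1) Δ _ (by lia), naturality]
  · ext Δ
    exact (x (Δ.len + 1)).comp_app Δ _

end SkeletalInduction

open MonoidalCategory

/-! ### Morphisms from the boundary of a simplex -/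

section Boundary

open SSet

lemma stdSimplex_map_comp {Δ Δ' Δ'' : SimplexCategory} (φ : Δ ⟶ Δ') (ψ : Δ' ⟶ Δ'') :
    SSet.stdSimplex.{u}.map (φ ≫ ψ) = SSet.stdSimplex.map φ ≫ SSet.stdSimplex.map ψ :=
  Functor.map_comp _ _ _

lemma image_len_lt_of_mem_boundary {n : ℕ} {m : SimplexCategoryᵒᵖ}
    {s : (Δ[n] : SSet.{u}).obj m} (hs : s ∈ (boundary n).obj m) :
    (image (SSet.stdSimplex.objEquiv s)).len < n := by
  set θ := SSet.stdSimplex.objEquiv s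
  by_contra h
  apply hs
  have hle : (image θ).len ≤ n := SimplexCategory.len_le_of_mono (image.ι θ)
  have : IsIso (image.ι θ) := (SimplexCategory.isIso_iff_of_mono _).2 (by
    dsimp; lia)
  have : Epi θ := by
    rw [← image.fac θ]
    infer_instance
  exact SimplexCategory.epi_iff_surjective.1 this

/-- The morphism to `∂Δ[n]` given by a map `Δ ⟶ ⦋n⦌` from an object of smaller dimension. -/
def toBoundary {n : ℕ} {Δ : SimplexCategory} (h : Δ.len < n) (θ : Δ ⟶ ⦋n⦌) :
    SSet.stdSimplex.{u}.obj Δ ⟶ (boundary n : SSet.{u}) :=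
  Subcomplex.lift (SSet.stdSimplex.map θ) (by
    rintro m _ ⟨t, rfl⟩ hsurj
    have hθ : Function.Surjective θ :=
      Function.Surjective.of_comp (g := ⇑(SSet.stdSimplex.asOrderHom t)) hsurj
    have : Epi θ := SimplexCategory.epi_iff_surjective.2 hθ
    exact absurd (SimplexCategory.len_le_of_epi θ) (not_le.2 h))

@[simp]
lemma toBoundary_ι {n : ℕ} {Δ : SimplexCategory} (h : Δ.len < n) (θ : Δ ⟶ ⦋n⦌) :
    toBoundary.{u} h θ ≫ (boundary n).ι = SSet.stdSimplex.map θ := rfl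

lemma boundary_hom_ext {n : ℕ} {Y : SSet.{u}} {f g : (boundary n : SSet.{u}) ⟶ Y}
    (H : ∀ (Δ : SimplexCategory) (h : Δ.len < n) (θ : Δ ⟶ ⦋n⦌),
      toBoundary h θ ≫ f = toBoundary h θ ≫ g) : f = g := by
  cases n with
  | zero => exact boundary.hom_ext₀
  | succ n => exact boundary.hom_ext fun i => H ⦋n⦌ (Nat.lt_succ_self n) (SimplexCategory.δ i)

/-- A compatible family of simplices of `Y`, indexed by all maps `Δ ⟶ ⦋n⦌` with `Δ` of dimension
`< n`, defines a morphism `∂Δ[n] ⟶ Y`. -/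
lemma exists_boundary_hom {n : ℕ} {Y : SSet.{u}}
    (y : ∀ (Δ : SimplexCategory) (_ : Δ.len < n) (_ : Δ ⟶ ⦋n⦌), SSet.stdSimplex.obj Δ ⟶ Y)
    (hy : ∀ (Δ Δ' : SimplexCategory) (h : Δ.len < n) (h' : Δ'.len < n) (φ : Δ' ⟶ Δ)
      (θ : Δ ⟶ ⦋n⦌), SSet.stdSimplex.map φ ≫ y Δ h θ = y Δ' h' (φ ≫ θ)) :
    ∃ f : (boundary n : SSet.{u}) ⟶ Y, ∀ (Δ : SimplexCategory) (h : Δ.len < n) (θ : Δ ⟶ ⦋n⦌),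
      toBoundary h θ ≫ f = y Δ h θ := by
  -- A nonsurjective `θ` is sent to the simplex attached to its image, pulled back along the
  -- epimorphism onto the image. Any other factorization `q ≫ ι` with `ι` mono gives the same result.
  have key (Δ : SimplexCategory) (Δ' : SimplexCategory) (h' : Δ'.len < n) (θ : Δ ⟶ ⦋n⦌)
      (q : Δ ⟶ Δ') (ι : Δ' ⟶ ⦋n⦌) [Mono ι] (e : q ≫ ι = θ) (h : (image θ).len < n) :
      SSet.stdSimplex.map (factorThruImage θ) ≫ y _ h (image.ι θ) =
        SSet.stdSimplex.map q ≫ y _ h' ι := by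
    let F : MonoFactorisation θ := { I := Δ', m := ι, e := q, fac := e }
    have h₁ : image.lift F ≫ ι = image.ι θ := image.lift_fac F
    have h₂ : factorThruImage θ ≫ image.lift F = q := image.fac_lift F
    have h₃ := hy _ _ h' h (image.lift F) ι
    rw [h₁] at h₃
    rw [← h₃, ← Category.assoc, ← stdSimplex_map_comp, h₂]
  refine ⟨{ app m := ↾fun s => (SSet.yonedaEquiv (SSet.stdSimplex.map (factorThruImage
              (SSet.stdSimplex.objEquiv s.1)) ≫ y _ (image_len_lt_of_mem_boundary s.2) (image.ι _)))
            naturality := ?_ }, ?_⟩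
  · intro m m' φ
    ext s
    have h := image_len_lt_of_mem_boundary s.2
    have h' := image_len_lt_of_mem_boundary (((boundary n : SSet.{u}).map φ s).2)
    have := key _ _ h (φ.unop ≫ SSet.stdSimplex.objEquiv s.1)
      (φ.unop ≫ factorThruImage (SSet.stdSimplex.objEquiv s.1)) (image.ι _) (by simp) h'
    refine (congr_arg SSet.yonedaEquiv this).trans ?_
    rw [stdSimplex_map_comp, Category.assoc]
    exact (SSet.yonedaEquiv_naturality _ _).symm
  · intro Δ h θ
    have key' (θ' : Δ ⟶ ⦋n⦌) (e : θ' = θ) (h' : (image θ').len < n) :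
        SSet.yonedaEquiv (SSet.stdSimplex.map (factorThruImage θ') ≫ y _ h' (image.ι θ')) =
          SSet.yonedaEquiv (y Δ h θ) := by
      subst e
      rw [hy _ _ h' h, image.fac]
    exact SSet.yonedaEquiv.injective (key' _ (Category.id_comp θ) _)

end Boundary

/-! ### Extending families of maps along `K ⊗ Δ[n] ⟶ L ⊗ Δ[n]` -/

section TensorExtension

open SSet

/-- All maps to `X` extend along monomorphisms, i.e. `X` is a (nonempty) contractible Kan
complex. -/
def ExtendsAlongMono (X : SSet.{u}) : Prop :=
  ∀ ⦃A B : SSet.{u}⦄ (i : A ⟶ B) [Mono i] (f : A ⟶ X), ∃ g : B ⟶ X, i ≫ g = f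

/-- The cosimplicial simplicial set `L ⊗ Δ[n]`. -/
abbrev tensorSimplex (L : SSet.{u}) : SimplexCategory ⥤ SSet.{u} :=
  SSet.stdSimplex ⋙ tensorLeft L

/-- The morphism `K ⊗ Δ[n] ⟶ L ⊗ Δ[n]` induced by `K ⟶ L`. -/
abbrev tensorSimplexMap {K L : SSet.{u}} (i : K ⟶ L) : tensorSimplex K ⟶ tensorSimplex L :=
  Functor.whiskerLeft SSet.stdSimplex ((curriedTensor SSet.{u}).map i)

variable {G : SimplexCategory ⥤ SSet.{u}} {L : SSet.{u}} (K : L.Subcomplex)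

/-- The step of the skeletal induction for `K ⊗ Δ[n] ⟶ L ⊗ Δ[n]`: the data on `K ⊗ Δ[n]` and on the
faces are a map on `K ⊗ Δ[n] ∪ L ⊗ ∂Δ[n]`, which extends to `L ⊗ Δ[n]`. -/
lemma exists_isFaceCompatible (hG : ∀ Δ, ExtendsAlongMono (G.obj Δ))
    {b : tensorSimplex (K : SSet.{u}) ⟶ G} {n : ℕ}
    (x : PartialExtension (tensorSimplexMap K.ι) b n) (Δ : SimplexCategory) (hΔ : Δ.len = n) :
    ∃ y : (tensorSimplex L).obj Δ ⟶ G.obj Δ, x.IsFaceCompatible y := by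
  obtain rfl : Δ = ⦋n⦌ := SimplexCategory.ext hΔ
  -- what is known on `L ⊗ ∂Δ[n]`, as a map from `∂Δ[n]` to an internal hom
  obtain ⟨f, hf⟩ := exists_boundary_hom (n := n)
    (fun Δ h θ => MonoidalClosed.curry (x.app Δ h ≫ G.map θ)) (by
      intro Δ Δ' h h' φ θ
      rw [← MonoidalClosed.curry_natural_left, G.map_comp]
      exact congr_arg _ ((reassoc_of% (x.naturality h' h φ)) _))
  have hf' (Δ : SimplexCategory) (h : Δ.len < n) (θ : Δ ⟶ ⦋n⦌) :
      L ◁ toBoundary h θ ≫ MonoidalClosed.uncurry f = x.app Δ h ≫ G.map θ := by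
    rw [← MonoidalClosed.uncurry_natural_left, hf, MonoidalClosed.uncurry_curry]
  have w : K.ι ▷ _ ≫ MonoidalClosed.uncurry f = (K : SSet.{u}) ◁ (boundary n).ι ≫ b.app ⦋n⦌ := by
    apply MonoidalClosed.curry_injective
    refine boundary_hom_ext fun Δ h θ => ?_
    rw [← MonoidalClosed.curry_natural_left, ← MonoidalClosed.curry_natural_left,
      whisker_exchange_assoc, hf', ← whiskerLeft_comp_assoc, toBoundary_ι]
    congr 1
    exact ((reassoc_of% (x.comp_app Δ h)) _).trans (b.naturality θ).symm
  obtain ⟨y, hy⟩ := hG ⦋n⦌ (K.unionProd (boundary n)).ι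
    ((Subcomplex.unionProd.isPushout K (boundary n)).desc _ _ w)
  have h₁ : L ◁ (boundary n).ι ≫ y = MonoidalClosed.uncurry f := by
    rw [← Subcomplex.unionProd.ι₁_ι K, Category.assoc, hy, IsPushout.inl_desc]
  have h₂ : K.ι ▷ _ ≫ y = b.app ⦋n⦌ := by
    rw [← Subcomplex.unionProd.ι₂_ι, Category.assoc, hy, IsPushout.inr_desc]
  refine ⟨y, ⟨fun h θ => ?_, h₂⟩⟩
  rw [← hf', ← h₁, ← whiskerLeft_comp_assoc, toBoundary_ι]
  rfl

/-- If `G` is dual to a split simplicial object and takes values in contractible Kan complexes, then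
all families of maps `K ⊗ Δ[n] ⟶ G ⦋n⦌` extend to `L ⊗ Δ[n]`. -/
theorem exists_tensor_extension {M : SimplexCategory → SSet.{u}} {pr : ∀ Δ, G.obj Δ ⟶ M Δ}
    (hpr : ∀ Δ, IsLimit (cosplitFan pr Δ)) (hG : ∀ Δ, ExtendsAlongMono (G.obj Δ))
    (b : tensorSimplex (K : SSet.{u}) ⟶ G) :
    ∃ h : tensorSimplex L ⟶ G, tensorSimplexMap K.ι ≫ h = b :=
  exists_extension hpr _ b fun _ x => exists_isFaceCompatible K hG x

end TensorExtension

/-! ### Simplicial sets of morphisms into a simplicial object -/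

section HomSSet

open SSet SimplicialObject.Splitting

variable {C : Type w} [Category.{v} C]

/-- The simplicial set `n ↦ (T ⟶ U n)`, contravariantly functorial in `T`. -/
def homSSet (U : SimplicialObject C) : Cᵒᵖ ⥤ SSet.{v} :=
  (Functor.flip (U ⋙ yoneda : SimplexCategoryᵒᵖ ⥤ Cᵒᵖ ⥤ Type v))

/-- The cosimplicial simplicial set `n ↦ (m ↦ (W n ⟶ U m))`. -/
abbrev homCosimplicial (W U : SimplicialObject C) : SimplexCategory ⥤ SSet.{v} :=
  Functor.rightOp W ⋙ homSSet U

variable {W : SimplicialObject C} (s : SimplicialObject.Splitting W) (U : SimplicialObject C)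

/-- Restriction of morphisms `W n ⟶ U m` to the nondegenerate part of `W n`. -/
def restrictNondegenerate (Δ : SimplexCategory) :
    (homCosimplicial W U).obj Δ ⟶ (homSSet U).obj (op (s.N Δ.len)) :=
  (homSSet U).map (s.ι Δ.len).op

lemma map_restrictNondegenerate_apply {Δ : SimplexCategory} (A : IndexSet (op Δ))
    (m : SimplexCategoryᵒᵖ) (x : W.obj (op Δ) ⟶ U.obj m) :
    ((homCosimplicial W U).map A.e ≫ restrictNondegenerate s U A.1.unop).app m x =
      ((s.cofan (op Δ)).inj A ≫ x : s.N A.1.unop.len ⟶ U.obj m) :=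
  (Category.assoc _ _ _).symm

/-- A splitting of `W` decomposes the simplicial sets of morphisms out of the `W n`. -/
def isLimitCosplitFan (Δ : SimplexCategory) :
    IsLimit (cosplitFan (restrictNondegenerate s U) Δ) :=
  Fan.IsLimit.mk _
    (fun g =>
      { app m := ↾fun x => s.desc (op Δ) (fun A => (g.proj A).app m x)
        naturality m m' φ := by
          ext x
          refine s.hom_ext' _ _ fun A => ?_
          refine (s.ι_desc _ _ _).trans ?_
          refine (ConcreteCategory.congr_hom ((g.proj A).naturality φ) x).trans ?_
          exact (s.ι_desc_assoc (op Δ) (fun A => (g.proj A).app m x) A (U.map φ)).symm })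
    (fun g A => by
      ext m x
      exact (map_restrictNondegenerate_apply s U A m _).trans
        (s.ι_desc (op Δ) (fun A => (g.proj A).app m x) A))
    (fun g t ht => by
      ext m x
      refine s.hom_ext' _ _ fun A => ?_
      refine Eq.trans ?_ (s.ι_desc _ _ _).symm
      rw [← ht A]
      exact (map_restrictNondegenerate_apply s U A m _).symm)

/-- The projections of `cosk n U`, as a limit of the objects of `U` in degrees `≤ n`, are induced by
the structure maps of `U`. -/
lemma coskAdj_unit_app_comp [HasFiniteLimits C] (n : ℕ) {Δ : SimplexCategory}
    {Y : (SimplexCategory.Truncated n)ᵒᵖ}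
    (θ : op Δ ⟶ (SimplexCategory.Truncated.inclusion n).op.obj Y) :
    ((SimplicialObject.coskAdj n).unit.app U).app (op Δ) ≫
      ((SimplicialObject.cosk n).obj U).map θ ≫
        ((SimplexCategory.Truncated.inclusion n).op.ranCounit.app
          ((SimplicialObject.truncation n).obj U)).app Y = U.map θ := by
  have h₁ := congr_app ((SimplicialObject.coskAdj n).left_triangle_components U) Y
  have h₂ := ((SimplicialObject.coskAdj n).unit.app U).naturality θ
  refine (Category.assoc _ _ _).symm.trans
    ((congr_arg (· ≫ _) h₂.symm).trans ((Category.assoc _ _ _).trans ?_))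
  refine (congr_arg (U.map θ ≫ ·) ?_).trans (Category.comp_id _)
  refine Eq.trans ?_ h₁
  rw [SimplicialObject.coskAdj, Functor.ranAdjunction_counit]
  rfl

/-- A compatible family of morphisms `T ⟶ U Δ'`, indexed by the maps `Δ' ⟶ Δ` with `Δ'` of
dimension `≤ n`, is a morphism `z` from `T` to the `n`-coskeleton of `U` in degree `Δ`. A lift of `z`
to `U Δ` is a morphism `T ⟶ U Δ` which induces the given family. -/
lemma exists_hom_cosk [HasFiniteLimits C] {T : C} {n : ℕ} {Δ : SimplexCategory}
    (y : ∀ (Δ' : SimplexCategory) (_ : Δ'.len ≤ n) (_ : Δ' ⟶ Δ), T ⟶ U.obj (op Δ'))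
    (hy : ∀ (Δ' Δ'' : SimplexCategory) (h' : Δ'.len ≤ n) (h'' : Δ''.len ≤ n) (φ : Δ'' ⟶ Δ')
      (θ : Δ' ⟶ Δ), y Δ' h' θ ≫ U.map φ.op = y Δ'' h'' (φ ≫ θ)) :
    ∃ z : T ⟶ ((SimplicialObject.cosk n).obj U).obj (op Δ), ∀ t : T ⟶ U.obj (op Δ),
      t ≫ ((SimplicialObject.coskAdj n).unit.app U).app (op Δ) = z →
        ∀ (Δ' : SimplexCategory) (h' : Δ'.len ≤ n) (θ : Δ' ⟶ Δ),
          t ≫ U.map θ.op = y Δ' h' θ := by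
  let L := (SimplexCategory.Truncated.inclusion n).op
  let F := (SimplicialObject.truncation n).obj U
  let c : Cone (StructuredArrow.proj (op Δ) L ⋙ F) :=
    { pt := T
      π := { app g := y g.right.unop.obj g.right.unop.property g.hom.unop
             naturality g g' k := by
              have h := hy g.right.unop.obj g'.right.unop.obj g.right.unop.property
                g'.right.unop.property k.right.unop.hom g.hom.unop
              refine (Category.id_comp _).trans (Eq.trans ?_ h.symm)
              congr 1
              exact congr_arg Quiver.Hom.unop (StructuredArrow.w k).symm } }
  have hl := L.isPointwiseRightKanExtensionRanCounit F (op Δ)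
  refine ⟨hl.lift c, fun t ht Δ' h' θ => ?_⟩
  let Y : (SimplexCategory.Truncated n)ᵒᵖ := op ⟨Δ', h'⟩
  let g : StructuredArrow (op Δ) L := StructuredArrow.mk (Y := Y) (show op Δ ⟶ L.obj Y from θ.op)
  have h₁ := hl.fac c g
  rw [← ht] at h₁
  exact (congr_arg (t ≫ ·) (coskAdj_unit_app_comp U n (Δ := Δ) (Y := Y) θ.op).symm).trans
    ((Category.assoc _ _ _).symm.trans h₁)

/-- If the maps `U 0 ⟶ *` and `U (n + 1) ⟶ (cosk n U) (n + 1)` are surjective on `T`-points, then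
the simplicial set of `T`-points of `U` is a contractible Kan complex. -/
theorem homSSet_extendsAlongMono [HasFiniteLimits C] (T : C) (h₀ : Nonempty (T ⟶ U _⦋0⦌))
    (h₁ : ∀ (n : ℕ) (z : T ⟶ ((SimplicialObject.cosk n).obj U) _⦋n + 1⦌), ∃ y : T ⟶ U _⦋n + 1⦌,
      y ≫ ((SimplicialObject.coskAdj n).unit.app U).app (op ⦋n + 1⦌) = z) :
    ExtendsAlongMono ((homSSet U).obj (op T)) := by
  set X := (homSSet U).obj (op T)
  have hδ {n : ℕ} (i : Fin (n + 2)) (t : X _⦋n + 1⦌) :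
      SSet.yonedaEquiv (SSet.stdSimplex.δ i ≫ SSet.yonedaEquiv.symm t) = X.δ i t := by
    rw [SSet.stdSimplex.yonedaEquiv_δ_comp, Equiv.apply_symm_apply]
  -- it suffices to extend along the inclusions of boundaries of simplices
  have hI : ∀ (n : ℕ) (f : (boundary n : SSet.{v}) ⟶ X), ∃ g : Δ[n] ⟶ X,
      (boundary n).ι ≫ g = f := by
    rintro (_ | n) f
    · obtain ⟨y⟩ := h₀
      exact ⟨SSet.yonedaEquiv.symm y, boundary.hom_ext₀⟩
    · obtain ⟨z, hz⟩ := exists_hom_cosk U (T := T) (n := n) (Δ := ⦋n + 1⦌)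
        (fun Δ' h' θ => SSet.yonedaEquiv (toBoundary (Nat.lt_succ_of_le h') θ ≫ f)) (by
          intro Δ' Δ'' h' h'' φ θ
          refine (SSet.yonedaEquiv_naturality (X := X) φ
            (toBoundary (Nat.lt_succ_of_le h') θ ≫ f)).trans (congr_arg SSet.yonedaEquiv ?_)
          rw [← Category.assoc]
          congr 1)
      obtain ⟨t, ht⟩ := h₁ n z
      refine ⟨SSet.yonedaEquiv.symm t, boundary.hom_ext fun i => ?_⟩
      apply SSet.yonedaEquiv.injective
      refine Eq.trans ?_ (hz t ht ⦋n⦌ le_rfl (SimplexCategory.δ i))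
      exact hδ i t
  have hrlp : modelCategoryQuillen.I.{v}.rlp (terminal.from X) := by
    rintro _ _ _ ⟨n⟩
    refine ⟨fun {f g} sq => ?_⟩
    obtain ⟨l, hl⟩ := hI n f
    exact ⟨⟨{ l := l, fac_left := hl, fac_right := Subsingleton.elim _ _ }⟩⟩
  rw [← rlp_monomorphisms] at hrlp
  intro A B i _ f
  have := hrlp i (MorphismProperty.monomorphisms.infer_property i)
  have sq : CommSq f i (terminal.from X) (terminal.from B) := ⟨Subsingleton.elim _ _⟩
  exact ⟨sq.lift, sq.fac_left⟩

/-! ### Morphisms and homotopies from families of simplices -/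

/-- The simplex `(l, 𝟙)` of `L ⊗ Δ`. -/
def tensorSimplexPoint {L : SSet.{v}} {Δ : SimplexCategory} (l : L.obj (op Δ)) :
    ((tensorSimplex L).obj Δ).obj (op Δ) :=
  (l, SSet.stdSimplex.objEquiv.symm (𝟙 Δ))

lemma map_tensorSimplexPoint {L : SSet.{v}} {Δ Δ' : SimplexCategory} (θ : Δ ⟶ Δ')
    (l : L.obj (op Δ')) :
    ((tensorSimplex L).obj Δ').map θ.op (tensorSimplexPoint l) =
      ((tensorSimplex L).map θ).app (op Δ) (tensorSimplexPoint (L.map θ.op l)) := by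
  refine Prod.ext rfl ?_
  exact congr_arg SSet.stdSimplex.objEquiv.symm
    ((Category.comp_id θ).trans (Category.id_comp θ).symm)

/-- The morphism `W Δ ⟶ U Δ` given by a family of maps `L ⊗ Δ[n] ⟶ (W n ⟶ U)` and a simplex
of `L`. -/
def evalSimplex {L : SSet.{v}} {U : SimplicialObject C} (h : tensorSimplex L ⟶ homCosimplicial W U)
    {Δ : SimplexCategory} (l : L.obj (op Δ)) : W.obj (op Δ) ⟶ U.obj (op Δ) :=
  (h.app Δ).app (op Δ) (tensorSimplexPoint l)

lemma evalSimplex_naturality {L : SSet.{v}} {U : SimplicialObject C}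
    (h : tensorSimplex L ⟶ homCosimplicial W U) {Δ Δ' : SimplexCategory} (θ : Δ ⟶ Δ')
    (l : L.obj (op Δ')) :
    evalSimplex h l ≫ U.map θ.op = W.map θ.op ≫ evalSimplex h (L.map θ.op l) := by
  have h₁ := ConcreteCategory.congr_hom ((h.app Δ').naturality θ.op) (tensorSimplexPoint l)
  have h₂ := ConcreteCategory.congr_hom (congr_app (h.naturality θ) (op Δ))
    (tensorSimplexPoint (L.map θ.op l))
  refine h₁.symm.trans (Eq.trans ?_ h₂)
  exact congr_arg ((h.app Δ').app (op Δ)) (map_tensorSimplexPoint θ l)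

end HomSSet

/-! ### Morphisms and homotopies from a split simplicial object -/

section SplitSource

open SSet

variable {C : Type w} [Category.{v} C] {W U : SimplicialObject C}

/-- The family of maps `K ⊗ Δ[n] ⟶ (W n ⟶ U)` given by a morphism `W ⟶ U` for each connected
component of `K`, i.e. by a function on the simplices of `K` that is invariant under simplicial
operators. -/
def tensorSimplexDesc {K : SSet.{v}} (p : ∀ m : SimplexCategoryᵒᵖ, K.obj m → (W ⟶ U))
    (hp : ∀ (m m' : SimplexCategoryᵒᵖ) (φ : m ⟶ m') (k : K.obj m), p m' (K.map φ k) = p m k) :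
    tensorSimplex K ⟶ homCosimplicial W U where
  app Δ :=
    { app m := ↾fun x =>
        (W.map (SSet.stdSimplex.objEquiv x.2).op ≫ (p m x.1).app m : W.obj (op Δ) ⟶ U.obj m)
      naturality m m' φ := by
        ext x
        change W.map (φ.unop ≫ SSet.stdSimplex.objEquiv x.2).op ≫ (p m' (K.map φ x.1)).app m' =
          (W.map (SSet.stdSimplex.objEquiv x.2).op ≫ (p m x.1).app m) ≫ U.map φ
        rw [hp, op_comp, W.map_comp, Category.assoc, Category.assoc, ← (p m x.1).naturality]
        rfl }
  naturality Δ Δ' θ := by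
    ext m x
    change W.map (SSet.stdSimplex.objEquiv x.2 ≫ θ).op ≫ (p m x.1).app m =
      W.map θ.op ≫ W.map (SSet.stdSimplex.objEquiv x.2).op ≫ (p m x.1).app m
    rw [op_comp, W.map_comp, Category.assoc]

lemma evalSimplex_tensorSimplexDesc {K : SSet.{v}}
    (p : ∀ m : SimplexCategoryᵒᵖ, K.obj m → (W ⟶ U))
    (hp : ∀ (m m' : SimplexCategoryᵒᵖ) (φ : m ⟶ m') (k : K.obj m), p m' (K.map φ k) = p m k)
    {Δ : SimplexCategory} (k : K.obj (op Δ)) :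
    evalSimplex (tensorSimplexDesc p hp) k = (p _ k).app (op Δ) := by
  change W.map (𝟙 (op Δ)) ≫ (p _ k).app (op Δ) = _
  rw [W.map_id, Category.id_comp]

/-- A family of maps `Δ[1] ⊗ Δ[n] ⟶ (W n ⟶ U)` is a simplicial homotopy between its values at the
two endpoints. -/
def homotopyOfTensorSimplex (H : tensorSimplex (Δ[1] : SSet.{v}) ⟶ homCosimplicial W U)
    {f g : W ⟶ U}
    (hf : ∀ n : ℕ, evalSimplex H (SSet.stdSimplex.objMk₁.{v} (Fin.last (n + 1))) = f.app (op ⦋n⦌))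
    (hg : ∀ n : ℕ, evalSimplex H (SSet.stdSimplex.objMk₁.{v} (n := n) 0) = g.app (op ⦋n⦌)) :
    SimplicialObject.Homotopy f g := by
  have hδ {n : ℕ} (i : Fin (n + 2)) (l : (Δ[1] : SSet.{v}) _⦋n + 1⦌) :
      evalSimplex H l ≫ U.δ i = W.δ i ≫ evalSimplex H (SimplicialObject.δ Δ[1] i l) :=
    evalSimplex_naturality H (SimplexCategory.δ i) l
  have hσ {n : ℕ} (i : Fin (n + 1)) (l : (Δ[1] : SSet.{v}) _⦋n⦌) :
      evalSimplex H l ≫ U.σ i = W.σ i ≫ evalSimplex H (SimplicialObject.σ Δ[1] i l) :=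
    evalSimplex_naturality H (SimplexCategory.σ i) l
  exact
  { h {n} i := W.σ i ≫ evalSimplex H (SSet.stdSimplex.objMk₁.{v} i.succ.castSucc)
    h_zero_comp_δ_zero n := by
      rw [Category.assoc, hδ, SSet.stdSimplex.δ_objMk₁_of_lt _ _ (by simp), ← hg]
      exact W.δ_comp_σ_self_assoc (i := (0 : Fin (n + 1))) _
    h_last_comp_δ_last n := by
      rw [Category.assoc, hδ, SSet.stdSimplex.δ_objMk₁_of_le _ _ (by simp), ← hf]
      exact W.δ_comp_σ_succ_assoc (i := Fin.last n) _
    h_succ_comp_δ_castSucc_of_lt {n} i j hij := by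
      rw [Category.assoc, hδ, SSet.stdSimplex.δ_objMk₁_of_lt, W.δ_comp_σ_of_le_assoc hij]
      · rfl
      · simp only [Fin.lt_def, Fin.le_def, Fin.val_castSucc, Fin.val_succ] at hij ⊢
        lia
    h_succ_comp_δ_castSucc_succ {n} i := by
      have h₁ : SimplicialObject.δ (Δ[1] : SSet.{v}) i.castSucc.succ
          (SSet.stdSimplex.objMk₁.{v} i.succ.succ.castSucc) =
          SimplicialObject.δ Δ[1] i.castSucc.succ
            (SSet.stdSimplex.objMk₁.{v} i.castSucc.succ.castSucc) := by
        rw [SSet.stdSimplex.δ_objMk₁_of_lt _ _ (by simp),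
          SSet.stdSimplex.δ_objMk₁_of_le _ _ (by simp)]
        rfl
      rw [Category.assoc, Category.assoc, hδ, hδ, h₁, W.δ_comp_σ_succ_assoc,
        ← Fin.castSucc_succ, W.δ_comp_σ_self_assoc]
    h_castSucc_comp_δ_succ_of_lt {n} i j hij := by
      rw [Category.assoc, hδ, SSet.stdSimplex.δ_objMk₁_of_le, W.δ_comp_σ_of_gt_assoc hij]
      · rfl
      · simpa using! Fin.le_of_lt hij
    h_comp_σ_castSucc_of_le {n} i j hij := by
      rw [Category.assoc, hσ, SSet.stdSimplex.σ_objMk₁_of_lt, W.σ_comp_σ_assoc hij]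
      · rfl
      · simpa
    h_comp_σ_succ_of_lt {n} i j hij := by
      rw [Category.assoc, hσ, SSet.stdSimplex.σ_objMk₁_of_le, ← W.σ_comp_σ_assoc hij]
      · rfl
      · simpa }

variable (s : SimplicialObject.Splitting W)
  (hU : ∀ n : ℕ, ExtendsAlongMono ((homSSet U).obj (op (W _⦋n⦌))))

include s hU

/-- A split simplicial object `W` has a morphism to `U` as soon as `U` is a contractible Kan complex
on `W n`-points for all `n`. -/
theorem nonempty_hom_of_splitting : Nonempty (W ⟶ U) := by
  -- a family of maps `Δ[0] ⊗ Δ[n] ⟶ (W n ⟶ U)` is a morphism `W ⟶ U`, and nothing is prescribed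
  let K : (Δ[0] : SSet.{v}).Subcomplex := ⊥
  obtain ⟨h, -⟩ := exists_tensor_extension (L := Δ[0]) K (isLimitCosplitFan s U)
    (fun Δ => hU Δ.len) (tensorSimplexDesc (fun m k => k.2.elim) (fun m m' φ k => k.2.elim))
  have hsub (m : SimplexCategoryᵒᵖ) (x y : (Δ[0] : SSet.{v}).obj m) : x = y :=
    SSet.stdSimplex.objEquiv.injective (Subsingleton.elim _ _)
  exact ⟨{ app m := evalSimplex h (Δ := m.unop) (SSet.stdSimplex.objMk (OrderHom.const _ 0))
           naturality m m' φ := by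
            refine Eq.trans ?_ (evalSimplex_naturality h φ.unop _).symm
            exact congr_arg (fun x => W.map φ ≫ evalSimplex h x) (hsub _ _ _) }⟩

/-- Two morphisms `W ⟶ U` from a split simplicial object `W` are homotopic as soon as `U` is a
contractible Kan complex on `W n`-points for all `n`. -/
theorem nonempty_homotopy_of_splitting (f g : W ⟶ U) :
    Nonempty (SimplicialObject.Homotopy f g) := by
  classical
  -- a simplex of `∂Δ[1]` is constant
  have hconst (m : SimplexCategoryᵒᵖ) (k : (boundary.{v} 1 : SSet.{v}).obj m)
      (i j : Fin (m.unop.len + 1)) :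
      SSet.stdSimplex.asOrderHom k.1 i = SSet.stdSimplex.asOrderHom k.1 j := by
    by_contra h
    refine k.2 fun c => ?_
    obtain hc | hc : SSet.stdSimplex.asOrderHom k.1 i = c ∨
        SSet.stdSimplex.asOrderHom k.1 j = c := by lia
    · exact ⟨i, hc⟩
    · exact ⟨j, hc⟩
  -- the morphism prescribed at the endpoint `0` is `f`, the one at `1` is `g`
  let p (m : SimplexCategoryᵒᵖ) (k : (boundary.{v} 1 : SSet.{v}).obj m) : W ⟶ U :=
    if SSet.stdSimplex.asOrderHom k.1 0 = 0 then f else g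
  have hp (m m' : SimplexCategoryᵒᵖ) (φ : m ⟶ m') (k : (boundary.{v} 1 : SSet.{v}).obj m) :
      p m' ((boundary.{v} 1 : SSet.{v}).map φ k) = p m k := by
    dsimp only [p]
    rw [← hconst m k (φ.unop.toOrderHom 0) 0]
    rfl
  obtain ⟨H, hH⟩ := exists_tensor_extension (boundary 1) (isLimitCosplitFan s U)
    (fun Δ => hU Δ.len) (tensorSimplexDesc p hp)
  have hH' (n : ℕ) (k : (boundary.{v} 1 : SSet.{v}) _⦋n⦌) :
      evalSimplex H k.1 = (p _ k).app (op ⦋n⦌) := by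
    rw [← evalSimplex_tensorSimplexDesc p hp, ← hH]
    rfl
  refine ⟨homotopyOfTensorSimplex H (fun n => ?_) (fun n => ?_)⟩
  · have hmem : SSet.stdSimplex.objMk₁.{v} (Fin.last (n + 1)) ∈ (boundary.{v} 1).obj (op ⦋n⦌) := by
      intro hsurj
      obtain ⟨i, hi⟩ := hsurj 1
      have h₀ : SSet.stdSimplex.asOrderHom (SSet.stdSimplex.objMk₁.{v} (Fin.last (n + 1))) i = 0 :=
        SSet.stdSimplex.objMk₁_of_castSucc_lt.{v} _ _ (Fin.castSucc_lt_last i)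
      exact absurd (h₀.symm.trans hi) (by simp)
    rw [hH' n ⟨_, hmem⟩]
    rfl
  · have hmem : SSet.stdSimplex.objMk₁.{v} (n := n) 0 ∈ (boundary.{v} 1).obj (op ⦋n⦌) := by
      intro hsurj
      obtain ⟨i, hi⟩ := hsurj 0
      have h₁ : SSet.stdSimplex.asOrderHom (SSet.stdSimplex.objMk₁.{v} (n := n) 0) i = 1 :=
        SSet.stdSimplex.objMk₁_of_le_castSucc.{v} _ _ (Fin.zero_le _)
      exact absurd (h₁.symm.trans hi) (by simp)
    rw [hH' n ⟨_, hmem⟩]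
    rfl

end SplitSource

/-! ### Lifting along coverings of the pro-étale site -/

section Lifting

variable {S : Scheme.{u}}

/-- Morphisms from a weakly contractible object lift along coverings, since a covering is a
surjection of representable sheaves. -/
lemma IsWeaklyContractible.exists_lift {W U X : S.ProEt} (hW : IsWeaklyContractible W) {f : U ⟶ X}
    (hf : IsCovering f) (x : W ⟶ X) : ∃ y : W ⟶ U, y ≫ f = x := by
  let φ : (Scheme.ProEt.topology S).yoneda.obj U ⟶ (Scheme.ProEt.topology S).yoneda.obj X :=
    (Scheme.ProEt.topology S).yoneda.map f
  have hφ : Sheaf.IsLocallySurjective φ := by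
    constructor
    intro T t
    refine (Scheme.ProEt.topology S).superset_covering ?_
      ((Scheme.ProEt.topology S).pullback_stable (t : T ⟶ X)
        (Precoverage.generate_mem_toGrothendieck hf))
    rintro V v ⟨Y, k, _, ⟨⟩, hk⟩
    exact ⟨k, hk⟩
  obtain ⟨y, hy⟩ := hW _ _ φ hφ (x : W ⟶ X)
  exact ⟨y, hy⟩

/-- The simplicial set of morphisms from a weakly contractible object to a hypercovering is a
contractible Kan complex. -/
lemma IsHypercovering.extendsAlongMono {U : SimplicialObject S.ProEt} (hU : IsHypercovering U)
    {W : S.ProEt} (hW : IsWeaklyContractible W) :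
    ExtendsAlongMono ((homSSet U).obj (op W)) :=
  homSSet_extendsAlongMono U W
    ⟨(hW.exists_lift hU.zero (terminal.from W)).choose⟩
    (fun n z => hW.exists_lift (hU.succ n) z)

/-- A split and degreewise weakly contractible hypercovering is an initial object of the homotopy
category of hypercoverings. -/
def isInitialToHoHy {W : SimplicialObject S.ProEt} (hW : IsHypercovering W) (hsplit : IsSplit W)
    (hawc : IsAffineWeaklyContractible W) : IsInitial (toHoHy W hW) :=
  have hU {U : SimplicialObject S.ProEt} (hU : IsHypercovering U) (n : ℕ) :
      ExtendsAlongMono ((homSSet U).obj (op (W _⦋n⦌))) :=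
    hU.extendsAlongMono (hawc n).2
  IsInitial.ofUniqueHom
    (fun ⟨U⟩ => (CategoryTheory.Quotient.functor (hyHomotopyRel S)).map
      (ObjectProperty.homMk
        (nonempty_hom_of_splitting hsplit.some (hU U.property)).some))
    (by
      rintro ⟨U⟩ m
      obtain ⟨f, rfl⟩ := (CategoryTheory.Quotient.functor (hyHomotopyRel S)).map_surjective m
      exact CategoryTheory.Quotient.sound _
        (nonempty_homotopy_of_splitting hsplit.some (hU U.property) _ _))

end Lifting

/-! ### Pro-objects whose index category has an initial object -/

/-- A pro-object is isomorphic to its value at an initial index. -/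
lemma ProObject.isIso_toConst {C : Type w} [Category.{v} C] (X : ProObject.{a, b} C) {i : X.Index}
    (hi : IsInitial i) : IsIso (X.toConst i) := by
  let F : ProObject.const (X.diagram.obj i) ⟶ X := ProObject.Hom.mk
    (fun j => (ProObject.const (X.diagram.obj i)).germ .star (X.diagram.map (hi.to j)))
    (fun {j j'} g => by
      rw [ProObject.germ_push]
      exact congr_arg _ ((X.diagram.map_comp _ _).symm.trans
        (congr_arg X.diagram.map (hi.hom_ext _ _))))
  refine ⟨F, ?_, ?_⟩
  · refine ProObject.Hom.ext (funext fun j => ?_)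
    change X.germ i (𝟙 _ ≫ X.diagram.map (hi.to j)) = X.germ j (𝟙 _)
    rw [← X.germ_map (hi.to j) (𝟙 _), Category.comp_id, Category.id_comp]
  · refine ProObject.Hom.ext (funext fun j => ?_)
    change (ProObject.const (X.diagram.obj i)).germ .star (X.diagram.map (hi.to i) ≫ 𝟙 _) =
      (ProObject.const (X.diagram.obj i)).germ j (𝟙 _)
    rw [hi.hom_ext (hi.to i) (𝟙 i), X.diagram.map_id, Category.comp_id]
    rfl

end ProetaleHomotopy

end

theorem mainTheorem1 (S : Scheme.{u}) [CompactSpace S] (W : SimplicialObject S.ProEt)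
    (hW : ProetaleHomotopy.IsHypercovering W)
    (hsplit : ProetaleHomotopy.IsSplit W)
    (hawc : ProetaleHomotopy.IsAffineWeaklyContractible W) :
    (Functor.fromPUnit.{0} (ProetaleHomotopy.toHoHy W hW)).Initial ∧
      ∃ _ : IsCofiltered (ProetaleHomotopy.HoHy S),
        IsIso (ProetaleHomotopy.proEtHomotopyTypeTo W hW) := by
  have hi := ProetaleHomotopy.isInitialToHoHy hW hsplit hawc
  have : IsCofiltered (ProetaleHomotopy.HoHy S) := IsCofiltered.of_isInitial _ hi
  exact ⟨Functor.initial_fromPUnit_of_isInitial hi, this,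
    ProetaleHomotopy.ProObject.isIso_toConst _ hi⟩
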